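/- The \emph{chain graph generated by} a binary sequence $b=(b_1b_2\cdots b_n)$ with $b_1=0$ is the bipartite graph on vertices $v_1,\dots,v_n$, where $v_i$ is white if $b_i=0$ and black if $b_i=1$, and where each black vertex $v_j$ is adjacent exactly to the white vertices $v_i$ with $i<j$. A \emph{chain graph} is a graph isomorphic to one generated by such a sequence. A \emph{Hamilton cycle} of a graph is a cycle (regarded as a subgraph, so without starting point and direction) that passes through all of its vertices, and a graph is \emph{Hamiltonian} if it has a Hamilton cycle. \textbf{Theorem.} Let $h\ge 2$. Among the Hamiltonian chain graphs of order $n=2h$, the minimum number of Hamilton cycles is $2^{h-2}$. Moreover, up to isomorphism, this minimum is attained uniquely, by the chain graph generated by $$(0^{t_1}1^{s_1})(0^{t_2}1^{s_2})\cdots(0^{t_k}1^{s_k}),\qquad k=h-1,\quad t_1=2,\ s_k=2,\ t_i=1\ (i\neq 1),\ s_j=1\ (j\neq k),$$ that is, by $(0^21)(01)\cdots(01)(01^2)$ with $h-1$ blocks (for $h=2$: $0^21^2$). -/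

import Mathlib

/-- The chain graph generated by a binary sequence `b` (`false` is the letter `0`, `true` is `1`).
The vertices are the positions of `b`, added from left to right: a position with letter `0` is a
white vertex, isolated at the time it is added, and a position with letter `1` is a black vertex,
joined to all white vertices added before it (and to nothing else). -/
def chainGraph (b : List Bool) : SimpleGraph (Fin b.length) where
  Adj i j := (i < j ∧ b.get i = false ∧ b.get j = true) ∨
    (j < i ∧ b.get j = false ∧ b.get i = true)
  symm := ⟨fun _ _ hij => Or.symm hij⟩
  loopless := ⟨fun i hi => by rcases hi with hi | hi <;> exact lt_irrefl i hi.1⟩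

/-- A chain graph: a graph isomorphic to one generated by a (nonempty) binary sequence whose first
letter is `0`. -/
def IsChainGraph {V : Type*} (G : SimpleGraph V) : Prop :=
  ∃ b : List Bool, b.head? = some false ∧ Nonempty (G ≃g chainGraph b)

/-- The Hamilton cycles of `G`, each identified with its set of edges; so neither the starting
vertex nor the direction of traversal matters. -/
def hamiltonCycles {V : Type*} [DecidableEq V] (G : SimpleGraph V) : Set (Set (Sym2 V)) :=
  {E | ∃ (a : V) (p : G.Walk a a), p.IsHamiltonianCycle ∧ E = p.edgeSet}

/-- The number of Hamilton cycles of `G`. -/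
noncomputable def numHamiltonCycles {V : Type*} [DecidableEq V] (G : SimpleGraph V) : ℕ :=
  (hamiltonCycles G).ncard

/-- The binary sequence `(0^{t₁} 1^{s₁}) (0^{t₂} 1^{s₂}) ⋯` given by the list of pairs
`(tᵢ, sᵢ)`. -/
def ofRuns (l : List (ℕ × ℕ)) : List Bool :=
  l.flatMap fun r => List.replicate r.1 false ++ List.replicate r.2 true

/-- The binary sequence `(0²1)(01)⋯(01)(01²)` with `k` bracketed blocks: `t₁ = 2`, `s_k = 2` and all
other `tᵢ`, `sᵢ` are `1`; for `k = 1` it is `0²1²`. -/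
def minSeq (k : ℕ) : List Bool :=
  ofRuns (List.ofFn fun i : Fin k =>
    (if (i : ℕ) = 0 then 2 else 1, if (i : ℕ) + 1 = k then 2 else 1))

open Finset

/-! Let u be the last black vertex, the one with the largest neighbourhood. Reading every Hamilton
cycle from u in both directions doubles the count (`two_mul_numHamiltonCycles`). The neighbourhoods
of black vertices are nested, so no other black vertex distinguishes the neighbours of a black
vertex b of smallest degree d. Hence a passage w, b, w' can be contracted to w, and the directed
count is d(d-1) times the count with b and one of its neighbours deleted (`card_closedPaths_eq_sum`,
`card_closedPaths`). With h black vertices the recursion collects h-1 such factors. A nonzero factor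
is at least 2, with equality only for d = 2, so a positive directed count is at least 2^(h-1).
Equality forces the original black degrees 2, 3, ..., h, h (`directedCycleCount_pos`), and these,
with the number of white vertices, determine the sequence (`eq_of_blackDegrees_eq`). -/

open Classical in
/-- The lists `l` that enumerate `S` without repetition and for which `u, l, u` is a closed walk. -/
noncomputable def closedPaths {V : Type*} (G : SimpleGraph V) (u : V) (S : Finset V) :
    Finset (List V) :=
  (⟨S.val.lists, Multiset.lists_nodup_finset S⟩ : Finset (List V)).filter fun l => (u :: (l ++ [u])).IsChain G.Adj

theorem mem_closedPaths {V : Type*} {G : SimpleGraph V} {u : V} {S : Finset V} {l : List V} :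
    l ∈ closedPaths G u S ↔ (l.Nodup ∧ ∀ x, x ∈ l ↔ x ∈ S) ∧ (u :: (l ++ [u])).IsChain G.Adj := by
  classical
  have key : l ∈ S.val.lists ↔ l.Nodup ∧ ∀ x, x ∈ l ↔ x ∈ S := by
    rw [Multiset.mem_lists_iff]
    constructor
    · intro h
      have h' : S.val = (l : Multiset V) := h
      refine ⟨?_, fun x => ?_⟩
      · rw [← Multiset.coe_nodup, ← h']; exact S.nodup
      · rw [← Finset.mem_val, h', Multiset.mem_coe]
    · rintro ⟨h1, h2⟩
      refine (Multiset.Nodup.ext S.nodup (Multiset.coe_nodup.2 h1)).2 fun x => ?_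
      rw [Finset.mem_val, Multiset.mem_coe, h2]
  rw [closedPaths, Finset.mem_filter, Finset.mem_mk, key]

/-! ### Hamilton cycles as vertex lists read from a fixed base point. -/

section HamiltonianWalks

variable {V : Type*} [DecidableEq V] {G : SimpleGraph V} {u : V}

open SimpleGraph

omit [DecidableEq V] in
theorem exists_walk_support_eq {a b : V} {L : List V} (hne : L ≠ []) (hc : L.IsChain G.Adj)
    (ha : L.head hne = a) (hb : L.getLast hne = b) : ∃ p : G.Walk a b, p.support = L := by
  subst ha hb
  exact ⟨Walk.ofSupport L hne hc, Walk.support_ofSupport hne hc⟩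

-- Each vertex of a cycle lies on just two of its edges, so once one is used to enter, the edge set
-- dictates the other.
omit [DecidableEq V] in
theorem eq_of_edgeSet_eq_of_snd_eq {p q : G.Walk u u} (hp : p.IsCycle) (hq : q.IsCycle)
    (hl : p.length = q.length) (hE : p.edgeSet = q.edgeSet)
    (h1 : p.getVert 1 = q.getVert 1) : p = q := by
  have h3 := hp.three_le_length
  have main : ∀ i, i + 1 ≤ p.length →
      p.getVert i = q.getVert i ∧ p.getVert (i + 1) = q.getVert (i + 1) := by
    intro i
    induction i with
    | zero => intro _; simpa using h1
    | succ i ih =>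
      intro hi
      obtain ⟨ha, hb⟩ := ih (by omega)
      refine ⟨hb, ?_⟩
      have he : s(p.getVert (i + 1), p.getVert (i + 1 + 1)) ∈ q.edges := by
        have : s(p.getVert (i + 1), p.getVert (i + 1 + 1)) ∈ p.edgeSet :=
          (p.mk_mem_edges_iff_exists).2 ⟨i + 1, by omega, rfl⟩
        rwa [hE] at this
      obtain ⟨j, hj, hje⟩ := (q.mk_mem_edges_iff_exists).1 he
      rw [hb] at hje
      rcases Sym2.eq_iff.1 hje with ⟨e1, e2⟩ | ⟨e1, e2⟩
      · have : i + 1 = j := hq.getVert_injOn' (by simp; omega) (by simp; omega) e1.symm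
        subst this; exact e2.symm
      · have : i + 1 = j + 1 :=
          hq.getVert_injOn (by simp; omega) (by simp; omega) e2.symm
        have hij : i = j := by omega
        subst hij
        -- Here `p` would return after two steps to the vertex it came from.
        exfalso
        have := hp.getVert_sub_one_ne_getVert_add_one (i := i + 1) (by omega)
        apply this
        simp only [Nat.add_sub_cancel]
        rw [ha, e1]
  refine Walk.ext_getVert_le_length hl fun k hk => ?_
  rcases k with _ | k
  · simp
  · exact (main k hk).2

omit [DecidableEq V] in
theorem eq_or_eq_reverse_of_edgeSet_eq {p q : G.Walk u u} (hp : p.IsCycle) (hq : q.IsCycle)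
    (hl : p.length = q.length) (hE : p.edgeSet = q.edgeSet) : p = q ∨ p = q.reverse := by
  have h3 := hp.three_le_length
  have he : s(p.getVert 0, p.getVert 1) ∈ q.edges := by
    have : s(p.getVert 0, p.getVert 1) ∈ p.edgeSet :=
      (p.mk_mem_edges_iff_exists).2 ⟨0, by omega, rfl⟩
    rwa [hE] at this
  obtain ⟨j, hj, hje⟩ := (q.mk_mem_edges_iff_exists).1 he
  rw [Walk.getVert_zero] at hje
  rcases Sym2.eq_iff.1 hje with ⟨e1, e2⟩ | ⟨e1, e2⟩
  · left
    rcases (hq.getVert_endpoint_iff (by omega)).1 e1 with rfl | h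
    · exact eq_of_edgeSet_eq_of_snd_eq hp hq hl hE e2.symm
    · omega
  · right
    refine eq_of_edgeSet_eq_of_snd_eq hp hq.reverse (by simpa using hl) ?_ ?_
    · rw [hE]; ext e; simp [Walk.mem_edgeSet]
    · rcases (hq.getVert_endpoint_iff (by omega)).1 e2 with h | h
      · omega
      · rw [Walk.getVert_reverse, ← h, Nat.add_sub_cancel, e1]

omit [DecidableEq V] in
theorem ne_reverse_of_isCycle {p : G.Walk u u} (hp : p.IsCycle) : p ≠ p.reverse := by
  intro h
  have h1 := hp.snd_ne_penultimate
  apply h1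
  conv_lhs => rw [h]
  simp

variable [Fintype V]

theorem exists_walk_of_mem_closedPaths (h3 : 3 ≤ Fintype.card V) {l : List V}
    (hl : l ∈ closedPaths G u (univ.erase u)) :
    ∃ p : G.Walk u u, p.IsHamiltonianCycle ∧ p.support = u :: (l ++ [u]) := by
  obtain ⟨⟨hnd, hmem⟩, hc⟩ := mem_closedPaths.1 hl
  have hne : u :: (l ++ [u]) ≠ [] := by simp
  obtain ⟨p, hp⟩ : ∃ p : G.Walk u u, p.support = u :: (l ++ [u]) :=
    exists_walk_support_eq hne hc (by simp) (by simp)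
  have hlen : l.length + 1 = Fintype.card V := by
    have : l.toFinset = univ.erase u := by ext x; simp [hmem]
    have h2 := List.toFinset_card_of_nodup hnd
    rw [this, card_erase_of_mem (mem_univ _), card_univ] at h2
    omega
  have hpl : p.length = Fintype.card V := by
    have := p.length_support
    rw [hp] at this
    simp at this
    omega
  refine ⟨p, ?_, hp⟩
  rw [Walk.isHamiltonianCycle_iff_isCycle_and_length_eq]
  refine ⟨Walk.isCycle_iff_isPath_tail_and_le_length.2 ⟨?_, by omega⟩, hpl⟩
  have hnn : ¬ p.Nil := by rw [← Walk.length_eq_zero_iff]; omega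
  rw [Walk.isPath_def, Walk.support_tail_of_not_nil _ hnn, hp, List.tail_cons]
  have hu : u ∉ l := by simp [hmem]
  rw [List.nodup_append]
  refine ⟨hnd, by simp, ?_⟩
  rintro a ha b hb rfl
  simp at hb
  exact hu (hb ▸ ha)

theorem exists_support_eq_of_isHamiltonianCycle {p : G.Walk u u} (hp : p.IsHamiltonianCycle) :
    ∃ l ∈ closedPaths G u (univ.erase u), p.support = u :: (l ++ [u]) := by
  have hnn := hp.isCycle.not_nil
  have ht : p.support.tail ≠ [] := by
    rw [← Walk.support_tail_of_not_nil _ hnn]; simp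
  have hs : p.support = u :: (p.support.tail.dropLast ++ [u]) := by
    conv_lhs => rw [← Walk.cons_tail_support]
    congr 1
    conv_lhs => rw [← List.dropLast_append_getLast ht]
    congr 2
    rw [List.getLast_tail]
    simp
  refine ⟨_, ?_, hs⟩
  rw [mem_closedPaths]
  have hcount : ∀ a, (p.support.tail.dropLast ++ [u]).count a = 1 := by
    have h := (Walk.isHamiltonianCycle_iff_isCycle_and_support_count_tail_eq_one.1 hp).2
    rw [hs, List.tail_cons] at h
    exact h
  have hndp : (p.support.tail.dropLast ++ [u]).Nodup :=
    List.nodup_iff_count_le_one.2 fun a => (hcount a).le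
  have hu : u ∉ p.support.tail.dropLast := by
    intro h
    exact (List.nodup_append.1 hndp).2.2 u h u (by simp) rfl
  refine ⟨⟨(List.nodup_append.1 hndp).1, fun x => ?_⟩, hs ▸ p.isChain_adj_support⟩
  constructor
  · intro hx
    simp only [mem_erase, mem_univ, and_true]
    rintro rfl
    exact hu hx
  · intro hx
    have h1 : x ∈ p.support.tail.dropLast ++ [u] := by
      rw [← List.count_pos_iff, hcount]; exact one_pos
    simpa [(mem_erase.1 hx).1] using h1

theorem two_mul_numHamiltonCycles (G : SimpleGraph V) (u : V) (h3 : 3 ≤ Fintype.card V) :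
    2 * numHamiltonCycles G = (closedPaths G u (univ.erase u)).card := by
  classical
  choose! P hP hPs using fun l (hl : l ∈ closedPaths G u (univ.erase u)) =>
    exists_walk_of_mem_closedPaths h3 hl
  have himg : ((closedPaths G u (univ.erase u)).image fun l => (P l).edgeSet : Set (Set (Sym2 V)))
      = hamiltonCycles G := by
    ext E
    simp only [coe_image, Set.mem_image, mem_coe, hamiltonCycles, Set.mem_ofPred_eq]
    constructor
    · rintro ⟨l, hl, rfl⟩
      exact ⟨u, P l, hP l hl, rfl⟩
    · rintro ⟨a, p, hp, rfl⟩
      have hu := hp.mem_support u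
      obtain ⟨l, hl, hs⟩ := exists_support_eq_of_isHamiltonianCycle (hp.rotate hu)
      refine ⟨l, hl, ?_⟩
      have : P l = p.rotate u hu := Walk.ext_support (by rw [hPs l hl, hs])
      rw [this]
      ext e
      simp only [Walk.mem_edgeSet]
      exact (p.rotate_edges u hu).mem_iff
  -- Each fibre of the edge set map consists of a list and its reversal.
  rw [card_eq_sum_card_image (fun l => (P l).edgeSet), sum_const_nat (m := 2), mul_comm,
    numHamiltonCycles, ← himg, Set.ncard_coe_finset]
  intro E hE
  obtain ⟨l, hl, rfl⟩ := mem_image.1 hE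
  obtain ⟨l', hl', hs'⟩ : ∃ l' ∈ closedPaths G u (univ.erase u),
      (P l).reverse.support = u :: (l' ++ [u]) := by
    apply exists_support_eq_of_isHamiltonianCycle
    rw [Walk.isHamiltonianCycle_iff_isCycle_and_length_eq]
    exact ⟨(hP l hl).isCycle.reverse, by simpa using (hP l hl).length_eq⟩
  have hr : P l' = (P l).reverse := Walk.ext_support (by rw [hPs l' hl', hs'])
  have hne : l ≠ l' := by
    rintro rfl
    exact ne_reverse_of_isCycle (hP l hl).isCycle hr
  rw [← card_pair hne]
  congr 1
  ext m
  simp only [mem_filter, mem_insert, mem_singleton]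
  constructor
  · rintro ⟨hm, hmE⟩
    have inj : ∀ m', m' ∈ closedPaths G u (univ.erase u) → P m = P m' → m = m' := by
      intro m' hm' h
      have := hPs m hm
      rw [h, hPs m' hm'] at this
      simpa using this.symm
    rcases eq_or_eq_reverse_of_edgeSet_eq (hP m hm).isCycle (hP l hl).isCycle
      ((hP m hm).length_eq.trans (hP l hl).length_eq.symm) hmE with h | h
    · exact Or.inl (inj l hl h)
    · exact Or.inr (inj l' hl' (h.trans hr.symm))
  · rintro (rfl | rfl)
    · exact ⟨hl, rfl⟩
    · refine ⟨hl', ?_⟩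
      rw [hr]; ext e; simp [Walk.mem_edgeSet]

end HamiltonianWalks

/-! ### Contraction of a black vertex of smallest neighbourhood. -/

section Contraction

variable {V : Type*} {G : SimpleGraph V} {u b : V} {white : V → Prop}

/-- Only the vertex after `w'` matters: if black it is adjacent to both `w` and `w'`, if white to
neither. -/
theorem isChain_contract_iff (hbip : ∀ x y, G.Adj x y → (white x ↔ ¬ white y)) (hb : ¬ white b)
    {w w' : V} {l₁ l₂ : List V} (hw : G.Adj b w) (hw' : G.Adj b w')
    (hnest : ∀ b', ¬ white b' → b' = u ∨ b' ∈ l₂ → G.Adj b' w ∧ G.Adj b' w') :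
    (u :: ((l₁ ++ w :: b :: w' :: l₂) ++ [u])).IsChain G.Adj ↔
      (u :: ((l₁ ++ w :: l₂) ++ [u])).IsChain G.Adj := by
  have hww : white w := by have := hbip _ _ hw; tauto
  have hww' : white w' := by have := hbip _ _ hw'; tauto
  obtain ⟨y, t, hyt⟩ : ∃ y t, l₂ ++ [u] = y :: t := List.exists_cons_of_ne_nil (by simp)
  have hy : y = u ∨ y ∈ l₂ := by
    have : y ∈ l₂ ++ [u] := by rw [hyt]; simp
    simpa [or_comm] using this
  have key : G.Adj w' y ↔ G.Adj w y := by
    constructor <;> intro h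
    · have := hbip _ _ h
      exact (hnest y (by tauto) hy).1.symm
    · have := hbip _ _ h
      exact (hnest y (by tauto) hy).2.symm
  have e1 : u :: ((l₁ ++ w :: b :: w' :: l₂) ++ [u]) = (u :: l₁) ++ w :: (b :: w' :: y :: t) := by
    simp [hyt]
  have e2 : u :: ((l₁ ++ w :: l₂) ++ [u]) = (u :: l₁) ++ w :: (y :: t) := by
    simp [hyt]
  rw [e1, e2, List.isChain_split, List.isChain_split (l₂ := y :: t), List.isChain_cons_cons,
    List.isChain_cons_cons, List.isChain_cons_cons, List.isChain_cons_cons, key]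
  have := hw.symm
  tauto

variable [DecidableEq V]

theorem flatMap_insert_after (b : V) {w w' : V} {l₁ l₂ : List V} (h₁ : w ∉ l₁) (h₂ : w ∉ l₂) :
    (l₁ ++ w :: l₂).flatMap (fun x => if x = w then [x, b, w'] else [x]) =
      l₁ ++ w :: b :: w' :: l₂ := by
  have key : ∀ l : List V, w ∉ l →
      l.flatMap (fun x => if x = w then [x, b, w'] else [x]) = l := by
    intro l
    induction l with
    | nil => simp
    | cons a l ih =>
      intro h
      simp only [List.mem_cons, not_or] at h
      simp [ih h.2, Ne.symm h.1]
  rw [List.flatMap_append, List.flatMap_cons, key _ h₁, key _ h₂]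
  simp

open Classical in
theorem card_closedPaths_eq_sum (hbip : ∀ x y, G.Adj x y → (white x ↔ ¬ white y))
    (hu : ¬ white u) {S : Finset V} (hbS : b ∈ S) (hb : ¬ white b)
    (hnest : ∀ b', ¬ white b' → b' = u ∨ b' ∈ S → ∀ w ∈ S, G.Adj b w → G.Adj b' w) :
    (closedPaths G u S).card =
      ∑ q ∈ (S.filter (G.Adj b ·)).offDiag, (closedPaths G u ((S.erase b).erase q.2)).card := by
  rw [← card_sigma]
  symm
  have spec : ∀ x ∈ (S.filter (G.Adj b ·)).offDiag.sigma
        (fun q => closedPaths G u ((S.erase b).erase q.2)),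
      ∃ l₁ l₂, x.2 = l₁ ++ x.1.1 :: l₂ ∧ x.1.1 ∉ l₁ ∧ x.1.1 ∉ l₂ ∧ b ∉ l₁ ∧ b ∉ l₂ ∧
        x.1.2 ∉ l₁ ∧ x.1.2 ∉ l₂ := by
    rintro ⟨⟨w, w'⟩, l⟩ hx
    simp only [mem_sigma, mem_offDiag, mem_filter] at hx
    obtain ⟨⟨⟨hwS, hw⟩, ⟨hwS', hw'⟩, hne⟩, hl⟩ := hx
    obtain ⟨⟨hnd, hmem⟩, hc⟩ := mem_closedPaths.1 hl
    have hwl : w ∈ l := (hmem w).2 (by simp [hne, hwS, hw.ne'])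
    have hbl : b ∉ l := fun h => by have := (hmem b).1 h; simp at this
    have hwl' : w' ∉ l := fun h => by have := (hmem w').1 h; simp at this
    obtain ⟨l₁, l₂, rfl⟩ := List.append_of_mem hwl
    refine ⟨l₁, l₂, rfl, ?_⟩
    rw [List.nodup_middle, List.nodup_cons] at hnd
    simp only [List.mem_append, List.mem_cons, not_or] at hnd hbl hwl'
    tauto
  -- The inverse of contraction: `b, w'` is inserted right after `w`, with no split of the list to
  -- be chosen.
  refine card_bij (fun x _ => x.2.flatMap fun y => if y = x.1.1 then [y, b, x.1.2] else [y])
    ?_ ?_ ?_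
  · intro x hx
    obtain ⟨l₁, l₂, hl, h₁, h₂, h₃, h₄, h₅, h₆⟩ := spec x hx
    obtain ⟨⟨w, w'⟩, l⟩ := x
    simp only at hl h₁ h₂ h₅ h₆
    subst hl
    simp only [mem_sigma, mem_offDiag, mem_filter] at hx
    obtain ⟨⟨⟨hwS, hw⟩, ⟨hwS', hw'⟩, hne⟩, hl⟩ := hx
    obtain ⟨⟨hnd, hmem⟩, hc⟩ := mem_closedPaths.1 hl
    dsimp only
    rw [flatMap_insert_after b h₁ h₂, mem_closedPaths]
    refine ⟨⟨?_, fun x => ?_⟩, ?_⟩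
    · have hbw := hw.ne
      have hbw' := hw'.ne
      rw [List.nodup_middle, List.nodup_cons] at hnd ⊢
      rw [List.nodup_middle, List.nodup_cons, List.nodup_middle, List.nodup_cons]
      simp only [List.mem_append, List.mem_cons, not_or] at hnd ⊢
      have := hw.ne'
      tauto
    · have := hmem x
      simp only [List.mem_append, List.mem_cons, mem_erase] at this ⊢
      constructor
      · rintro (h | rfl | rfl | rfl | h)
        · exact (this.1 (Or.inl h)).2.2
        · assumption
        · assumption
        · assumption
        · exact (this.1 (Or.inr (Or.inr h))).2.2
      · intro h
        tauto
    · rw [isChain_contract_iff hbip hb hw hw']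
      · exact hc
      · intro b' hb' hb'u
        have : b' = u ∨ b' ∈ S := by
          refine hb'u.imp_right fun h => ?_
          have := (hmem b').1 (by simp [h])
          simp only [mem_erase] at this
          exact this.2.2
        exact ⟨hnest b' hb' this w hwS hw, hnest b' hb' this w' hwS' hw'⟩
  · intro x hx y hy hxy
    obtain ⟨l₁, l₂, hl, h₁, h₂, h₃, h₄, h₅, h₆⟩ := spec x hx
    obtain ⟨m₁, m₂, hm, k₁, k₂, k₃, k₄, k₅, k₆⟩ := spec y hy
    obtain ⟨⟨w, w'⟩, l⟩ := x
    obtain ⟨⟨v, v'⟩, m⟩ := y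
    simp only at hl h₁ h₂ h₅ h₆ hm k₁ k₂ k₅ k₆
    subst hl hm
    dsimp only at hxy
    rw [flatMap_insert_after b h₁ h₂, flatMap_insert_after b k₁ k₂] at hxy
    simp only [mem_sigma, mem_offDiag, mem_filter] at hx
    -- Since `b` occurs only once, splitting there recovers `w`, `w'` and the rest.
    have hxy' : (l₁ ++ [w]) ++ b :: (w' :: l₂) = (m₁ ++ [v]) ++ b :: (v' :: m₂) := by
      simpa using hxy
    have hbw := hx.1.1.2.ne
    have hbw' := hx.1.2.1.2.ne
    rw [List.append_cons_inj_of_notMem (by simp [h₃, hbw]) (by simp [h₄, hbw'])] at hxy'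
    obtain ⟨e1, -, e2⟩ := hxy'
    obtain ⟨rfl, e3⟩ := List.append_inj' e1 rfl
    simp only [List.cons.injEq, and_true] at e2 e3
    obtain ⟨rfl, rfl⟩ := e2
    subst e3
    rfl
  · intro l hl
    obtain ⟨⟨hnd, hmem⟩, hc⟩ := mem_closedPaths.1 hl
    obtain ⟨s, t, rfl⟩ := List.append_of_mem ((hmem b).2 hbS)
    have hub : ∀ b', ¬ white b' → ¬ G.Adj b' b ∧ ¬ G.Adj b b' := by
      intro b' hb'
      constructor <;> intro h <;> have := hbip _ _ h <;> tauto
    -- At either end of the list `b` would be adjacent to `u`, which is black as well.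
    obtain ⟨l₁, w, rfl⟩ : ∃ l₁ w, s = l₁ ++ [w] := by
      rcases List.eq_nil_or_concat s with rfl | ⟨l₁, w, rfl⟩
      · simp only [List.nil_append, List.cons_append, List.isChain_cons_cons] at hc
        exact absurd hc.1 (hub u hu).1
      · exact ⟨l₁, w, by simp⟩
    obtain ⟨w', l₂, rfl⟩ : ∃ w' l₂, t = w' :: l₂ := by
      rcases t with _ | ⟨w', l₂⟩
      · rw [List.append_assoc, ← List.cons_append, List.cons_append (a := b),
          List.isChain_split, List.nil_append, List.isChain_cons_cons] at hc
        exact absurd hc.2.1 (hub u hu).2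
      · exact ⟨w', l₂, rfl⟩
    have e : l₁ ++ [w] ++ b :: w' :: l₂ = l₁ ++ w :: b :: w' :: l₂ := by simp
    rw [e] at hl hc hnd hmem ⊢
    have hadj : G.Adj w b ∧ G.Adj b w' := by
      have e1 : u :: ((l₁ ++ w :: b :: w' :: l₂) ++ [u]) =
          (u :: l₁) ++ w :: (b :: w' :: (l₂ ++ [u])) := by simp
      rw [e1, List.isChain_split, List.isChain_cons_cons, List.isChain_cons_cons] at hc
      exact ⟨hc.2.1, hc.2.2.1⟩
    obtain ⟨hw, hw'⟩ := hadj
    have hwS : w ∈ S := (hmem w).1 (by simp)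
    have hwS' : w' ∈ S := (hmem w').1 (by simp)
    rw [isChain_contract_iff hbip hb hw.symm hw'] at hc
    swap
    · intro b' hb' hb'u
      have : b' = u ∨ b' ∈ S := hb'u.imp_right fun h => (hmem b').1 (by simp [h])
      exact ⟨hnest b' hb' this w hwS hw.symm, hnest b' hb' this w' hwS' hw'⟩
    rw [List.nodup_middle, List.nodup_cons, List.nodup_middle, List.nodup_cons,
      List.nodup_middle, List.nodup_cons] at hnd
    simp only [List.mem_append, List.mem_cons, not_or] at hnd
    refine ⟨⟨(w, w'), l₁ ++ w :: l₂⟩, ?_, ?_⟩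
    · simp only [mem_sigma, mem_offDiag, mem_filter]
      refine ⟨⟨⟨hwS, hw.symm⟩, ⟨hwS', hw'⟩, hnd.1.2.2.1⟩, ?_⟩
      rw [mem_closedPaths]
      refine ⟨⟨?_, fun x => ?_⟩, hc⟩
      · rw [List.nodup_middle, List.nodup_cons]
        simp only [List.mem_append, not_or]
        tauto
      · have := hmem x
        simp only [List.mem_append, List.mem_cons] at this
        simp only [List.mem_append, List.mem_cons, mem_erase, ← this]
        constructor
        · rintro (h | rfl | h)
          · refine ⟨?_, ?_, by tauto⟩ <;> rintro rfl <;> tauto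
          · tauto
          · refine ⟨?_, ?_, by tauto⟩ <;> rintro rfl <;> tauto
        · tauto
    · dsimp only
      rw [flatMap_insert_after b (by tauto) (by tauto)]

end Contraction

/-! ### The recursion for the directed count and its minimum. -/

/-- The number of directed Hamilton cycles of the chain graph with `m` white vertices whose black
vertices have the degrees `ds`, in increasing order. -/
def directedCycleCount : ℕ → List ℕ → ℕ
  | _, [] => 0
  | m, [d] => if m = 1 ∧ d = 1 then 1 else 0
  | m, d :: e :: ds => (d * d - d) * directedCycleCount (m - 1) ((e :: ds).map (· - 1))
termination_by _ ds => ds.length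

open Classical in
theorem card_closedPaths {V : Type*} [DecidableEq V] {G : SimpleGraph V} {u : V}
    {white : V → Prop} (hbip : ∀ x y, G.Adj x y → (white x ↔ ¬ white y)) (hu : ¬ white u)
    (bs : List V) (W : Finset V) (hW : ∀ w ∈ W, white w) (hbs : ∀ b ∈ bs, ¬ white b)
    (hnd : bs.Nodup)
    (hnest : (bs ++ [u]).Pairwise fun b b' => ∀ w ∈ W, G.Adj b w → G.Adj b' w) :
    (closedPaths G u (W ∪ bs.toFinset)).card =
      directedCycleCount W.card ((bs ++ [u]).map fun b => (W.filter (G.Adj b ·)).card) := by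
  induction bs generalizing W with
  | nil =>
    simp only [List.toFinset_nil, union_empty, List.nil_append, List.map_cons, List.map_nil]
    -- The recursion ends at the degenerate closed walk `u, w, u`, counted once.
    rw [directedCycleCount]
    have hsing : ∀ l ∈ closedPaths G u W, ∃ w, l = [w] ∧ W = {w} ∧ G.Adj u w := by
      intro l hl
      obtain ⟨⟨hnd, hmem⟩, hc⟩ := mem_closedPaths.1 hl
      rcases l with _ | ⟨w, _ | ⟨w', l⟩⟩
      · simp at hc
      · refine ⟨w, rfl, ?_, ?_⟩
        · ext x; rw [← hmem]; simp
        · simp at hc; exact hc.1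
      · simp only [List.cons_append, List.isChain_cons_cons] at hc
        have h1 := hbip _ _ hc.2.1
        have h2 := hW w ((hmem w).1 (by simp))
        have h3 := hW w' ((hmem w').1 (by simp))
        tauto
    split_ifs with h
    · obtain ⟨w, rfl⟩ := card_eq_one.1 h.1
      have hw : G.Adj u w := by
        by_contra hw
        have := h.2
        simp [filter_singleton, hw] at this
      rw [card_eq_one]
      refine ⟨[w], ?_⟩
      ext l
      rw [mem_singleton]
      constructor
      · intro hl
        obtain ⟨w', rfl, h', -⟩ := hsing l hl
        rw [singleton_inj.1 h']
      · rintro rfl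
        rw [mem_closedPaths]
        simp [hw, hw.symm]
    · rw [card_eq_zero, eq_empty_iff_forall_notMem]
      intro l hl
      obtain ⟨w, rfl, rfl, hw⟩ := hsing l hl
      exact h (by simp [filter_singleton, hw])
  | cons b bs ih =>
    rw [List.nodup_cons] at hnd
    rw [List.cons_append, List.pairwise_cons] at hnest
    have hb : ¬ white b := hbs b (by simp)
    have hbW : b ∉ W := fun h => hb (hW b h)
    have hbs' : ∀ x ∈ bs, x ∉ W := fun x hx h => hbs x (by simp [hx]) (hW x h)
    have hfil : (W ∪ (b :: bs).toFinset).filter (G.Adj b ·) = W.filter (G.Adj b ·) := by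
      ext x
      simp only [List.toFinset_cons, mem_filter, mem_union, mem_insert, List.mem_toFinset]
      constructor
      · rintro ⟨h1, h2⟩
        refine ⟨?_, h2⟩
        rcases h1 with h1 | rfl | h1
        · exact h1
        · exact absurd rfl h2.ne
        · have := hbip _ _ h2
          have := hbs x (by simp [h1])
          tauto
      · tauto
    rw [card_closedPaths_eq_sum (b := b) hbip hu (by simp) hb, hfil]
    swap
    · intro b' hb' h1 w hw hbw
      have hw' : w ∈ W := by
        have : w ∈ (W ∪ (b :: bs).toFinset).filter (G.Adj b ·) := mem_filter.2 ⟨hw, hbw⟩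
        rw [hfil] at this
        exact (mem_filter.1 this).1
      simp only [List.toFinset_cons, mem_union, mem_insert, List.mem_toFinset] at h1
      rcases h1 with rfl | h1 | rfl | h1
      · exact hnest.1 b' (by simp) w hw' hbw
      · exact absurd (hW b' h1) hb'
      · exact hbw
      · exact hnest.1 b' (by simp [h1]) w hw' hbw
    obtain ⟨e, t, het⟩ : ∃ e t, bs ++ [u] = e :: t := List.exists_cons_of_ne_nil (by simp)
    rw [List.cons_append, het, List.map_cons, List.map_cons, directedCycleCount,
      ← List.map_cons (f := fun b => (W.filter (G.Adj b ·)).card),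
      ← het, ← offDiag_card, List.map_map, ← smul_eq_mul, ← sum_const]
    refine sum_congr rfl fun q hq => ?_
    simp only [mem_offDiag, mem_filter] at hq
    obtain ⟨⟨hwS, hw⟩, ⟨hwS', hw'⟩, hne⟩ := hq
    have hS : ((W ∪ (b :: bs).toFinset).erase b).erase q.2 = W.erase q.2 ∪ bs.toFinset := by
      ext x
      simp only [List.toFinset_cons, mem_erase, mem_union, mem_insert, List.mem_toFinset]
      constructor
      · tauto
      · rintro (h | h)
        · refine ⟨h.1, ?_, Or.inl h.2⟩
          rintro rfl; exact hbW h.2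
        · refine ⟨?_, ?_, Or.inr (Or.inr h)⟩
          · rintro rfl; exact hbs' _ h hwS'
          · rintro rfl; exact hnd.1 h
    rw [hS, ih (W.erase q.2) (fun w h => hW w (mem_of_mem_erase h))
      (fun x hx => hbs x (by simp [hx])) hnd.2
      (hnest.2.imp fun h w hw => h w (mem_of_mem_erase hw)), card_erase_of_mem hwS']
    congr 1
    -- By nesting, every remaining black vertex is adjacent to the deleted `q.2`, so its degree
    -- drops by exactly one.
    refine List.map_congr_left fun x hx => ?_
    rw [Function.comp_apply, filter_erase, card_erase_of_mem]
    exact mem_filter.2 ⟨hwS', hnest.1 x hx _ hwS' hw'⟩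

/-- The black degrees, in increasing order, of the chain graph with `n + 1` white vertices that
minimizes the number of Hamilton cycles. -/
def extremalDegrees : ℕ → List ℕ
  | 0 => [1]
  | n + 1 => 2 :: (extremalDegrees n).map (· + 1)

theorem one_le_of_mem_extremalDegrees {n x : ℕ} (hx : x ∈ extremalDegrees n) : 1 ≤ x := by
  cases n <;> simp [extremalDegrees] at hx <;> omega

theorem directedCycleCount_extremalDegrees (n : ℕ) :
    directedCycleCount (n + 1) (extremalDegrees n) = 2 ^ n := by
  induction n with
  | zero => simp [extremalDegrees, directedCycleCount]
  | succ n ih =>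
    obtain ⟨e, t, he⟩ : ∃ e t, (extremalDegrees n).map (· + 1) = e :: t := by
      cases n <;> simp [extremalDegrees]
    rw [extremalDegrees, he, directedCycleCount, ← he, List.map_map]
    have : ((fun x : ℕ => x - 1) ∘ fun x => x + 1) = id := by ext; simp
    rw [this, List.map_id, Nat.add_sub_cancel, ih, pow_succ]
    ring

theorem directedCycleCount_pos (m : ℕ) (ds : List ℕ) (hpos : 0 < directedCycleCount m ds) :
    ds.length = m ∧ ∃ n, m = n + 1 ∧ 2 ^ n ≤ directedCycleCount m ds ∧
      (directedCycleCount m ds = 2 ^ n → ds = extremalDegrees n) := by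
  induction m, ds using directedCycleCount.induct with
  | case1 => simp [directedCycleCount] at hpos
  | case2 m d h =>
    obtain ⟨rfl, rfl⟩ := h
    exact ⟨rfl, 0, rfl, by simp [directedCycleCount], by simp [extremalDegrees]⟩
  | case3 m d h => simp [directedCycleCount, h] at hpos
  | case4 m d e ds ih =>
    rw [directedCycleCount] at hpos ⊢
    set X := directedCycleCount (m - 1) ((e :: ds).map (· - 1)) with hX
    have hXpos : 0 < X := Nat.pos_of_mul_pos_left hpos
    have hdpos : 0 < d * d - d := Nat.pos_of_mul_pos_right hpos
    obtain ⟨hlen, n, hmn, hle, heq⟩ := ih hXpos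
    have hd2 : 2 ≤ d := by
      by_contra hlt
      have : d = 0 ∨ d = 1 := by omega
      rcases this with rfl | rfl <;> simp at hdpos
    obtain ⟨c, rfl⟩ := Nat.exists_eq_add_of_le hd2
    have hdd : (2 + c) * (2 + c) - (2 + c) = 2 + 3 * c + c * c := by
      have : (2 + c) * (2 + c) = 2 + 3 * c + c * c + (2 + c) := by ring
      omega
    rw [hdd]
    simp only [List.length_map, List.length_cons] at hlen
    refine ⟨by simp only [List.length_cons]; omega, n + 1, by omega, ?_, ?_⟩
    · rw [pow_succ, mul_comm]
      exact Nat.mul_le_mul (by omega) hle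
    · intro h
      rw [pow_succ] at h
      -- As `X` is positive and at least `2 ^ n`, the excess `(3c + c²)X` must vanish.
      have hc : c = 0 := by nlinarith [Nat.zero_le (c * c * X), Nat.zero_le (c * X)]
      subst hc
      have hT := heq (by omega)
      rw [extremalDegrees, ← hT, List.map_map]
      congr 1
      conv_lhs => rw [← List.map_id (e :: ds)]
      refine List.map_congr_left fun x hx => ?_
      -- Entries of `extremalDegrees` are at least 1, so the truncated subtraction loses nothing and
      -- can be undone.
      have : x - 1 ∈ extremalDegrees n := by
        rw [← hT]; exact List.mem_map_of_mem hx
      have := one_le_of_mem_extremalDegrees this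
      simp only [id, Function.comp_apply]
      omega

/-! ### Binary sequences and their black degrees. -/

/-- The degrees of the black vertices of `chainGraph b`, from left to right, each increased
by `k`. -/
def blackDegrees : ℕ → List Bool → List ℕ
  | _, [] => []
  | k, false :: b => blackDegrees (k + 1) b
  | k, true :: b => k :: blackDegrees k b

theorem length_blackDegrees (k : ℕ) (b : List Bool) :
    (blackDegrees k b).length = b.count true := by
  induction b generalizing k with
  | nil => simp [blackDegrees]
  | cons x b ih => cases x <;> simp [blackDegrees, ih]

theorem le_of_mem_blackDegrees {k x : ℕ} {b : List Bool} (hx : x ∈ blackDegrees k b) : k ≤ x := by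
  induction b generalizing k with
  | nil => simp [blackDegrees] at hx
  | cons y b ih =>
    cases y
    · have := ih (k := k + 1) hx
      omega
    · rw [blackDegrees, List.mem_cons] at hx
      rcases hx with rfl | hx
      · rfl
      · exact ih hx

theorem blackDegrees_succ (k : ℕ) (b : List Bool) :
    blackDegrees (k + 1) b = (blackDegrees k b).map (· + 1) := by
  induction b generalizing k with
  | nil => simp [blackDegrees]
  | cons x b ih => cases x <;> simp [blackDegrees, ih]

/-- The number of zeros is needed because black degrees do not see trailing zeros. -/
theorem eq_of_blackDegrees_eq {k : ℕ} {b b' : List Bool} (h : blackDegrees k b = blackDegrees k b')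
    (hc : b.count false = b'.count false) : b = b' := by
  induction b generalizing k b' with
  | nil =>
    rcases b' with _ | ⟨_ | _, b'⟩
    · rfl
    · simp at hc
    · simp [blackDegrees] at h
  | cons x b ih =>
    rcases b' with _ | ⟨y, b'⟩
    · cases x
      · simp at hc
      · simp [blackDegrees] at h
    · cases x <;> cases y
      · rw [ih (k := k + 1) h (by simpa using hc)]
      · have : k ∈ blackDegrees k (false :: b) := by rw [h]; simp [blackDegrees]
        have := le_of_mem_blackDegrees (k := k + 1) this
        omega
      · have : k ∈ blackDegrees k (false :: b') := by rw [← h]; simp [blackDegrees]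
        have := le_of_mem_blackDegrees (k := k + 1) this
        omega
      · simp only [blackDegrees, List.cons.injEq, true_and] at h
        rw [ih h (by simpa using hc)]

section MinSeq

/-- Without its leading 0 the minimal sequence is self-similar: prefixing `01` gives the next one.
The offset 1 accounts for the removed 0. -/
theorem blackDegrees_ofRuns_ofFn (n : ℕ) :
    let b := ofRuns (List.ofFn fun i : Fin (n + 1) => (1, if (i : ℕ) + 1 = n + 1 then 2 else 1))
    blackDegrees 1 b = extremalDegrees (n + 1) ∧ b.count false = n + 1 ∧ b.count true = n + 2 := by
  induction n with
  | zero => simp [ofRuns, blackDegrees, extremalDegrees, List.replicate]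
  | succ n ih =>
    have : ofRuns (List.ofFn fun i : Fin (n + 1 + 1) =>
        (1, if (i : ℕ) + 1 = n + 1 + 1 then 2 else 1)) = false :: true :: ofRuns
          (List.ofFn fun i : Fin (n + 1) => (1, if (i : ℕ) + 1 = n + 1 then 2 else 1)) := by
      simp [ofRuns]
    rw [this]
    obtain ⟨h1, h2, h3⟩ := ih
    refine ⟨?_, ?_, ?_⟩
    · rw [blackDegrees, blackDegrees, blackDegrees_succ, h1]
      rfl
    · rw [List.count_cons_self, List.count_cons_of_ne (by simp), h2]
    · rw [List.count_cons_of_ne (by simp), List.count_cons_self, h3]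

theorem minSeq_succ (n : ℕ) : minSeq (n + 1) = false :: ofRuns
    (List.ofFn fun i : Fin (n + 1) => (1, if (i : ℕ) + 1 = n + 1 then 2 else 1)) := by
  simp [minSeq, ofRuns, List.ofFn_succ, List.replicate]

theorem blackDegrees_minSeq (n : ℕ) :
    blackDegrees 0 (minSeq (n + 1)) = extremalDegrees (n + 1) := by
  rw [minSeq_succ, blackDegrees, (blackDegrees_ofRuns_ofFn n).1]

theorem count_false_minSeq (n : ℕ) : (minSeq (n + 1)).count false = n + 2 := by
  rw [minSeq_succ, List.count_cons_self, (blackDegrees_ofRuns_ofFn n).2.1]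

theorem length_minSeq (n : ℕ) : (minSeq (n + 1)).length = 2 * (n + 2) := by
  rw [← List.count_true_add_count_false, count_false_minSeq, minSeq_succ,
    List.count_cons_of_ne (by simp), (blackDegrees_ofRuns_ofFn n).2.2]
  ring

end MinSeq

/-! ### The directed count of a chain graph from its sequence. -/

section ChainGraph

theorem card_filter_get_eq_false (b : List Bool) :
    (univ.filter fun j : Fin b.length => b.get j = false).card = b.count false := by
  induction b with
  | nil => simp
  | cons x b ih =>
    rw [List.count_cons, ← ih]
    refine (Fin.card_filter_univ_succ (n := b.length) _).trans ?_
    cases x <;> simp [add_comm]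

theorem map_card_filter_eq_blackDegrees (k : ℕ) (b : List Bool) :
    ((List.finRange b.length).filter fun i => b.get i).map
      (fun i => k + (univ.filter fun j : Fin b.length => j < i ∧ b.get j = false).card) =
      blackDegrees k b := by
  induction b generalizing k with
  | nil => simp [blackDegrees]
  | cons x b ih =>
    have key : ∀ i : Fin b.length,
        (univ.filter fun j : Fin (b.length + 1) => j < i.succ ∧ (x :: b).get j = false).card =
        (if x = false then 1 else 0) +
          (univ.filter fun j : Fin b.length => j < i ∧ b.get j = false).card := by
      intro i
      refine (Fin.card_filter_univ_succ (n := b.length) _).trans ?_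
      cases x <;> simp [add_comm]
    simp only [List.length_cons] at *
    rw [List.finRange_succ, List.filter_cons, List.filter_map]
    have hcomp : ((fun i : Fin (b.length + 1) => (x :: b).get i) ∘ Fin.succ) =
      fun i => b.get i := by ext i; simp
    rw [hcomp]
    cases x
    · rw [blackDegrees, ← ih, if_neg (by simp), List.map_map]
      refine List.map_congr_left fun i _ => ?_
      rw [Function.comp_apply, key, if_pos rfl, add_assoc]
    · rw [blackDegrees, ← ih, if_pos (by simp), List.map_cons, List.map_map]
      congr 1
      · simp
      · refine List.map_congr_left fun i _ => ?_
        rw [Function.comp_apply, key, if_neg (by simp), zero_add]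

theorem two_mul_numHamiltonCycles_chainGraph (b : List Bool) (h3 : 3 ≤ b.length) :
    2 * numHamiltonCycles (chainGraph b) =
      directedCycleCount (b.count false) (blackDegrees 0 b) := by
  classical
  set blk := (List.finRange b.length).filter fun i => b.get i with hblk
  have hmem : ∀ i, i ∈ blk ↔ b.get i = true := by simp [hblk]
  have hdeg := map_card_filter_eq_blackDegrees 0 b
  rw [← hblk] at hdeg
  rcases List.eq_nil_or_concat blk with h0 | ⟨bs, u, hbu⟩
  · rw [← hdeg, h0, List.map_nil, directedCycleCount]
    have : hamiltonCycles (chainGraph b) = ∅ := by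
      rw [Set.eq_empty_iff_forall_notMem]
      rintro E ⟨a, p, hp, -⟩
      have hadj := p.adj_snd hp.isCycle.not_nil
      have hno : ∀ i, b.get i ≠ true := by
        intro i hi
        have := (hmem i).2 hi
        rw [h0] at this
        simp at this
      rcases hadj with h | h
      · exact hno _ h.2.2
      · exact hno _ h.2.2
    simp [numHamiltonCycles, this]
  · rw [List.concat_eq_append] at hbu
    set W := univ.filter fun j : Fin b.length => b.get j = false with hW
    have hub : b.get u = true := (hmem u).1 (by simp [hbu])
    have hadj : ∀ i w, b.get i = true →
        ((chainGraph b).Adj i w ↔ w < i ∧ b.get w = false) := by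
      intro i w hi
      simp only [chainGraph, hi]
      simp
    have hsorted : blk.Pairwise (· < ·) :=
      (List.pairwise_lt_finRange _).filter _
    have hnd : (bs ++ [u]).Nodup := by
      rw [← hbu]; exact hsorted.imp fun h => h.ne
    have hbs : ∀ x ∈ bs, b.get x = true := fun x hx => (hmem x).1 (by simp [hbu, hx])
    have hS : univ.erase u = W ∪ bs.toFinset := by
      ext x
      simp only [mem_erase, mem_univ, and_true, mem_union, hW, mem_filter, true_and,
        List.mem_toFinset]
      have h1 := hmem x
      rw [hbu, List.mem_append, List.mem_singleton] at h1
      constructor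
      · intro hx
        cases hbx : b.get x
        · exact Or.inl rfl
        · exact Or.inr ((h1.2 hbx).resolve_right hx)
      · rintro (hx | hx) rfl
        · rw [hub] at hx; simp at hx
        · exact (List.nodup_append.1 hnd).2.2 x hx x (by simp) rfl
    rw [two_mul_numHamiltonCycles _ u (by simpa using h3), hS,
      card_closedPaths (white := fun i => b.get i = false)]
    · rw [← hbu, ← hdeg, ← card_filter_get_eq_false]
      congr 1
      refine List.map_congr_left fun i hi => ?_
      rw [zero_add]
      congr 1
      ext w
      simp only [hW, mem_filter, mem_univ, true_and, hadj i w ((hmem i).1 hi)]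
      tauto
    · rintro x y (h | h) <;> rw [h.2.1, h.2.2] <;> simp
    · rw [hub]; simp
    · simp [hW]
    · intro x hx
      rw [hbs x hx]; simp
    · exact (List.nodup_append.1 hnd).1
    -- Later black vertices see more white ones, so order of position is order of inclusion of
    -- neighbourhoods.
    · rw [← hbu]
      refine hsorted.imp_of_mem fun {i j} hi hj hij w _ hw => ?_
      rw [hadj _ _ ((hmem _).1 hi)] at hw
      rw [hadj _ _ ((hmem _).1 hj)]
      exact ⟨hw.1.trans hij, hw.2⟩

end ChainGraph

/-! ### Isomorphism invariance and the conclusion. -/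

section Iso

open SimpleGraph

variable {V V' : Type*} [DecidableEq V] [DecidableEq V'] {G : SimpleGraph V} {G' : SimpleGraph V'}

theorem image_map_mem_hamiltonCycles (f : G ≃g G') {E : Set (Sym2 V)} (hE : E ∈ hamiltonCycles G) :
    Sym2.map f '' E ∈ hamiltonCycles G' := by
  obtain ⟨a, p, hp, rfl⟩ := hE
  refine ⟨_, p.map f.toHom, hp.map (f := f.toHom) f.bijective, ?_⟩
  ext e
  simp [Walk.mem_edgeSet]

theorem numHamiltonCycles_congr (f : G ≃g G') : numHamiltonCycles G = numHamiltonCycles G' := by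
  refine Set.ncard_congr (fun E _ => Sym2.map f '' E)
    (fun E hE => image_map_mem_hamiltonCycles f hE) ?_ ?_
  · intro E E' _ _ h
    exact (Set.image_injective.2 (Sym2.map.injective f.injective)) h
  · intro E hE
    refine ⟨_, image_map_mem_hamiltonCycles f.symm hE, ?_⟩
    rw [← Set.image_comp, ← Sym2.map_comp]
    have : (f ∘ f.symm : V' → V') = id := by ext; simp
    rw [this, Sym2.map_id, Set.image_id]

/-- Order 1 is excluded because `IsHamiltonian` holds there by convention, without a cycle. -/
theorem isHamiltonian_iff_numHamiltonCycles_pos [Fintype V] (h1 : Fintype.card V ≠ 1) :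
    G.IsHamiltonian ↔ 0 < numHamiltonCycles G := by
  rw [numHamiltonCycles, Set.ncard_pos (Set.toFinite _)]
  constructor
  · intro h
    obtain ⟨a, p, hp⟩ := h h1
    exact ⟨_, a, p, hp, rfl⟩
  · rintro ⟨_, a, p, hp, -⟩ _
    exact ⟨a, p, hp⟩

end Iso

theorem chainGraph_numHamiltonCycles_ge {b : List Bool} {n : ℕ} (hb : b.length = 2 * (n + 2))
    (hpos : 0 < numHamiltonCycles (chainGraph b)) :
    2 ^ n ≤ numHamiltonCycles (chainGraph b) ∧
      (numHamiltonCycles (chainGraph b) = 2 ^ n → b = minSeq (n + 1)) := by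
  have h := two_mul_numHamiltonCycles_chainGraph b (by omega)
  obtain ⟨hlen, m, hm, hle, heq⟩ := directedCycleCount_pos _ _ (by rw [← h]; omega)
  rw [length_blackDegrees] at hlen
  have hadd := List.count_true_add_count_false b
  have hmn : m = n + 1 := by omega
  subst hmn
  rw [← h, pow_succ] at hle
  refine ⟨by omega, fun hn => ?_⟩
  refine eq_of_blackDegrees_eq (k := 0) ?_ (by rw [count_false_minSeq, hm])
  rw [blackDegrees_minSeq]
  apply heq
  rw [← h, hn, pow_succ, mul_comm]

theorem numHamiltonCycles_chainGraph_minSeq (n : ℕ) :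
    numHamiltonCycles (chainGraph (minSeq (n + 1))) = 2 ^ n := by
  have h := two_mul_numHamiltonCycles_chainGraph (minSeq (n + 1)) (by rw [length_minSeq]; omega)
  rw [blackDegrees_minSeq, count_false_minSeq, directedCycleCount_extremalDegrees, pow_succ] at h
  omega

theorem mainTheorem3 {V : Type*} [Fintype V] [DecidableEq V] (h : ℕ) (hh : 2 ≤ h)
    (hV : Fintype.card V = 2 * h) :
    IsLeast {m : ℕ | ∃ G : SimpleGraph V,
        IsChainGraph G ∧ G.IsHamiltonian ∧ numHamiltonCycles G = m} (2 ^ (h - 2)) ∧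
      ∀ G : SimpleGraph V,
        (IsChainGraph G ∧ G.IsHamiltonian ∧ numHamiltonCycles G = 2 ^ (h - 2)) ↔
          Nonempty (G ≃g chainGraph (minSeq (h - 1))) := by
  obtain ⟨n, rfl⟩ := Nat.exists_eq_add_of_le' hh
  rw [show n + 2 - 2 = n by omega, show n + 2 - 1 = n + 1 by omega]
  have hV1 : Fintype.card V ≠ 1 := by omega
  have hmin : ∀ G : SimpleGraph V, Nonempty (G ≃g chainGraph (minSeq (n + 1))) →
      IsChainGraph G ∧ G.IsHamiltonian ∧ numHamiltonCycles G = 2 ^ n := by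
    rintro G ⟨f⟩
    have hn : numHamiltonCycles G = 2 ^ n :=
      (numHamiltonCycles_congr f).trans (numHamiltonCycles_chainGraph_minSeq n)
    refine ⟨⟨_, by rw [minSeq_succ]; rfl, ⟨f⟩⟩, ?_, hn⟩
    rw [isHamiltonian_iff_numHamiltonCycles_pos hV1, hn]
    positivity
  have hge : ∀ G : SimpleGraph V, IsChainGraph G → G.IsHamiltonian →
      2 ^ n ≤ numHamiltonCycles G ∧
        (numHamiltonCycles G = 2 ^ n → Nonempty (G ≃g chainGraph (minSeq (n + 1)))) := by
    rintro G ⟨b, -, ⟨f⟩⟩ hG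
    have hb : b.length = 2 * (n + 2) := by
      rw [← hV, Fintype.card_congr f.toEquiv, Fintype.card_fin]
    rw [isHamiltonian_iff_numHamiltonCycles_pos hV1] at hG
    rw [numHamiltonCycles_congr f] at hG ⊢
    obtain ⟨h1, h2⟩ := chainGraph_numHamiltonCycles_ge hb hG
    exact ⟨h1, fun h => by rw [← h2 h]; exact ⟨f⟩⟩
  refine ⟨⟨?_, ?_⟩, fun G => ⟨fun ⟨h1, h2, h3⟩ => (hge G h1 h2).2 h3, hmin G⟩⟩
  · have e : V ≃ Fin (minSeq (n + 1)).length :=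
      Fintype.equivFinOfCardEq (by rw [hV, length_minSeq])
    -- The minimum is attained on `V` by pulling the extremal graph back along `e`.
    exact ⟨_, hmin _ ⟨SimpleGraph.Iso.comap e _⟩⟩
  · rintro m ⟨G, h1, h2, rfl⟩
    exact (hge G h1 h2).1
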